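/- A (nonnegative Borel) measure $\mu$ on $\mathbf{R}$ is called exponentially integrable if $\int e_\lambda\, d\mu < +\infty$ for all $\lambda \in \mathbf{R}$, where $e_\lambda(x) = \exp(\lambda x)$. Let $M_{\exp}(\mathbf{R})$ be the set of exponentially integrable measures on $\mathbf{R}$, and let $P_{\exp}(\mathbf{R}) \subset M_{\exp}(\mathbf{R})$ be the set of exponentially integrable probability measures. For probability measures $\mu,\nu$ on $\mathbf{R}$ write $\mu \leq_{\mathrm{st}} \nu$ if $\mu[t,\infty) \leq \nu[t,\infty)$ for all $t \in \mathbf{R}$, and write $\mu \leq^*_{\mathrm{st}} \nu$ if there is an integer $n \geq 1$ such that $\mu^{*n} \leq_{\mathrm{st}} \nu^{*n}$, where $\mu^{*n}$ denotes the $n$-fold convolution power. Call $f : \mathbf{R} \to \mathbf{R}$ subexponential if there are constants $c, C$ with $|f(x)| \leq C \exp(c|x|)$ for all $x \in \mathbf{R}$. Let $\tau$ be the topology on $M_{\exp}(\mathbf{R})$ generated by the pseudometrics $(\mu,\nu) \mapsto \left|\int f\, d\mu - \int f\, d\nu\right|$, where $f$ ranges over the continuous subexponential functions. **Theorem.** Let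 $R \subset P_{\exp}(\mathbf{R})^2$ be the set of pairs $(\mu,\nu)$ of exponentially integrable probability measures such that $\mu \leq^*_{\mathrm{st}} \nu$. Then $$\overline{R} = \left\{ (\mu,\nu) \in P_{\exp}(\mathbf{R})^2 \;:\; \forall \lambda \geq 0,\ \int e_\lambda\, d\mu \leq \int e_\lambda\, d\nu \ \text{ and } \ \forall \lambda \leq 0,\ \int e_\lambda\, d\mu \geq \int e_\lambda\, d\nu \right\},$$ where the closure is taken in $M_{\exp}(\mathbf{R})^2$ with respect to the product topology of $\tau$ (equivalently in $P_{\exp}(\mathbf{R})^2$ with the subspace topology). -/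

import Mathlib

open MeasureTheory

noncomputable section

namespace StDom

/-- Stochastic domination: `μ[t,∞) ≤ ν[t,∞)` for all real `t`. -/
def StLE (μ ν : Measure ℝ) : Prop :=
  ∀ t : ℝ, μ (Set.Ici t) ≤ ν (Set.Ici t)

/-- The `n`-fold convolution power, with `μ^{*0} = δ₀`. -/
def convPow (μ : Measure ℝ) : ℕ → Measure ℝ
  | 0 => Measure.dirac 0
  | n + 1 => Measure.conv (convPow μ n) μ

/-- Some convolution power of `μ`, of order at least one, is stochastically dominated by the same
power of `ν`. -/
def StLEStar (μ ν : Measure ℝ) : Prop :=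
  ∃ n : ℕ, 1 ≤ n ∧ StLE (convPow μ n) (convPow ν n)

/-- All exponential functions `x ↦ exp (l * x)` are integrable. -/
def ExpIntegrable (μ : Measure ℝ) : Prop :=
  ∀ l : ℝ, Integrable (fun x : ℝ => Real.exp (l * x)) μ

def Subexponential (f : ℝ → ℝ) : Prop :=
  ∃ c C : ℝ, ∀ x : ℝ, |f x| ≤ C * Real.exp (c * |x|)

/-- The space of exponentially integrable measures on the real line. -/
def ExpMeasure : Type := {μ : Measure ℝ // ExpIntegrable μ}

/-- The underlying measure. -/
def ExpMeasure.meas (μ : ExpMeasure) : Measure ℝ := μ.1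

/-- Continuous subexponential functions. -/
def TestFun : Type := {f : ℝ → ℝ // Continuous f ∧ Subexponential f}

/-- The integral of a test function against an exponentially integrable measure is a genuine one. -/
theorem integrable_testFun (μ : ExpMeasure) (f : TestFun) : Integrable f.1 μ.meas := by
  obtain ⟨f, hf, c, C, h⟩ := f
  have hi : Integrable (fun x : ℝ => |C| * (Real.exp (c * x) + Real.exp (-c * x))) μ.meas :=
    ((μ.2 c).add (μ.2 (-c))).const_mul _
  refine hi.mono' hf.aestronglyMeasurable (Filter.Eventually.of_forall fun x => ?_)
  have h1 : Real.exp (c * |x|) ≤ Real.exp (c * x) + Real.exp (-c * x) := by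
    rcases abs_cases x with ⟨hx, _⟩ | ⟨hx, _⟩ <;> rw [hx]
    · linarith [Real.exp_pos (-c * x)]
    · rw [mul_neg, ← neg_mul]
      linarith [Real.exp_pos (c * x)]
  calc ‖f x‖ = |f x| := Real.norm_eq_abs _
    _ ≤ C * Real.exp (c * |x|) := h x
    _ ≤ |C| * Real.exp (c * |x|) := by gcongr; exact le_abs_self C
    _ ≤ _ := by gcongr

/-- The topology `τ` on exponentially integrable measures: the coarsest one making `μ ↦ ∫ f dμ`
continuous for every continuous subexponential `f`; equivalently, the one given by the
pseudometrics `|∫ f dμ - ∫ f dν|`. -/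
instance : TopologicalSpace ExpMeasure :=
  TopologicalSpace.induced (fun (μ : ExpMeasure) (f : TestFun) => ∫ x, f.1 x ∂μ.meas)
    Pi.topologicalSpace

/-- Pairs of exponentially integrable probability measures, as a subset of the pairs of
exponentially integrable measures. -/
def probPairs : Set (ExpMeasure × ExpMeasure) :=
  {p | IsProbabilityMeasure p.1.meas ∧ IsProbabilityMeasure p.2.meas}

/-- The graph of the relation `StLEStar` on exponentially integrable probability measures. -/
def relR : Set (ExpMeasure × ExpMeasure) :=
  {p | p ∈ probPairs ∧ StLEStar p.1.meas p.2.meas}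

end StDom

end

open MeasureTheory ProbabilityTheory
open scoped Topology Pointwise

namespace StDom

/-! ### Convolution powers -/

/-! The right-hand side contains the relation because Laplace transforms turn convolution powers
into ordinary powers, so an inequality for the `n`-th powers descends by taking `n`-th roots
(`mgf_le_of_stLEStar`). It is closed because every `e_λ`, including the constant `e_0` which detects
total mass, is a test function.

Conversely, an admissible pair is a limit of strict ones. `lowerApprox` truncates `μ` above and
moves a tiny mass far to the left; `upperApprox` is the mirror image for `ν`. This makes the
transforms strictly ordered at every nonzero argument, and likewise the means and both essential
bounds.

A strict pair is comparable at a large power (`stLEStar_of_strict`) by Cramér's theorem made uniform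
in the threshold. Write `φ`, `ψ` for the log-Laplace transforms of `μ`, `ν`. If `ψ'(l) = x`, the
tail of `μ^{*n}` beyond `n x` is at most `exp (n (φ l - l x))`, while that of `ν^{*n}` is about `exp
(n (ψ l - l x))`, which is larger since `φ l < ψ l`. Compactness of a range of tilts `[l₀, L]` gives
a single `n`: the tilt `l₀` alone serves small thresholds, and beyond `ψ'(L)` the `μ` tail vanishes.
Lower tails follow by reflection. -/

instance isProbabilityMeasure_convPow (μ : Measure ℝ) [IsProbabilityMeasure μ] (n : ℕ) :
    IsProbabilityMeasure (convPow μ n) := by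
  induction n with
  | zero => rw [convPow]; infer_instance
  | succ n ih => rw [convPow]; infer_instance

/-- The Laplace transform of a convolution power is a power of the Laplace transform. -/
theorem lintegral_exp_convPow (μ : Measure ℝ) [IsProbabilityMeasure μ] (l : ℝ) (n : ℕ) :
    ∫⁻ x, ENNReal.ofReal (Real.exp (l * x)) ∂convPow μ n =
      (∫⁻ x, ENNReal.ofReal (Real.exp (l * x)) ∂μ) ^ n := by
  induction n with
  | zero => simp [convPow]
  | succ n ih =>
    rw [convPow, Measure.lintegral_conv (by fun_prop)]
    simp_rw [mul_add, Real.exp_add, ENNReal.ofReal_mul (Real.exp_pos _).le]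
    simp_rw [lintegral_const_mul _
      (show Measurable fun y : ℝ => ENNReal.ofReal (Real.exp (l * y)) by fun_prop)]
    rw [lintegral_mul_const _ (by fun_prop), ih, pow_succ]

theorem ExpIntegrable.lintegral_exp {μ : Measure ℝ} (h : ExpIntegrable μ) (l : ℝ) :
    ∫⁻ x, ENNReal.ofReal (Real.exp (l * x)) ∂μ = ENNReal.ofReal (mgf id μ l) := by
  exact (ofReal_integral_eq_lintegral_ofReal (h l)
    (ae_of_all _ fun _ => (Real.exp_pos _).le)).symm

/-- Chernoff's bound for convolution powers. -/
theorem chernoff_convPow {μ : Measure ℝ} [IsProbabilityMeasure μ] (h : ExpIntegrable μ)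
    {l : ℝ} (hl : 0 ≤ l) (n : ℕ) (s : ℝ) :
    ENNReal.ofReal (Real.exp (l * s)) * convPow μ n (Set.Ici s) ≤
      ENNReal.ofReal (mgf id μ l ^ n) := by
  rw [ENNReal.ofReal_pow mgf_nonneg, ← h.lintegral_exp, ← lintegral_exp_convPow]
  refine le_trans ?_ (mul_meas_ge_le_lintegral (by fun_prop) (ENNReal.ofReal (Real.exp (l * s))))
  gcongr
  intro x hx
  have : s ≤ x := hx
  exact ENNReal.ofReal_le_ofReal (by gcongr)

theorem convPow_Ioi_eq_zero {μ : Measure ℝ} [IsProbabilityMeasure μ] {b : ℝ}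
    (h : μ (Set.Ioi b) = 0) (n : ℕ) : convPow μ n (Set.Ioi (n * b)) = 0 := by
  induction n with
  | zero => simp [convPow]
  | succ n ih =>
    rw [← lintegral_indicator_one measurableSet_Ioi, convPow,
      Measure.lintegral_conv (measurable_one.indicator measurableSet_Ioi),
      lintegral_eq_zero_iff' (by
        apply AEMeasurable.lintegral_prod_right'
          (f := fun p : ℝ × ℝ => (Set.Ioi (((n + 1 : ℕ) : ℝ) * b)).indicator 1 (p.1 + p.2))
        exact ((measurable_one.indicator measurableSet_Ioi).comp
          (measurable_fst.add measurable_snd)).aemeasurable)]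
    have h1 : ∀ᵐ x ∂convPow μ n, x ≤ n * b := by
      rw [ae_iff]; simpa [Set.Ioi] using ih
    have h2 : ∀ᵐ x ∂μ, x ≤ b := by
      rw [ae_iff]; simpa [Set.Ioi] using h
    filter_upwards [h1] with x hx
    refine (lintegral_eq_zero_iff' ?_).2 ?_
    · exact ((measurable_one.indicator measurableSet_Ioi).comp
        (measurable_const_add x)).aemeasurable
    filter_upwards [h2] with y hy
    apply Set.indicator_of_notMem
    simp only [Set.mem_Ioi, not_lt]
    push_cast
    linarith

/-- Mean and variance are additive along convolution powers. -/
theorem moments_convPow {ρ : Measure ℝ} [IsProbabilityMeasure ρ] (h : MemLp id 2 ρ) (n : ℕ) :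
    MemLp id 2 (convPow ρ n) ∧ ∫ x, x ∂convPow ρ n = n * ∫ x, x ∂ρ ∧
      Var[id; convPow ρ n] = n * Var[id; ρ] := by
  induction n with
  | zero =>
    refine ⟨?_, by simp [convPow], ?_⟩
    · exact (memLp_const (0 : ℝ)).ae_eq (by simp [convPow, Filter.EventuallyEq])
    · simp [convPow, variance_dirac]
  | succ n ih =>
    obtain ⟨h1, h2, h3⟩ := ih
    have hf : MemLp (fun p : ℝ × ℝ => p.1) 2 ((convPow ρ n).prod ρ) :=
      h1.comp_measurePreserving measurePreserving_fst
    have hs : MemLp (fun p : ℝ × ℝ => p.2) 2 ((convPow ρ n).prod ρ) :=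
      h.comp_measurePreserving measurePreserving_snd
    have hm : Measurable fun p : ℝ × ℝ => p.1 + p.2 := measurable_fst.add measurable_snd
    have hi : IndepFun (fun p : ℝ × ℝ => p.1) (fun p : ℝ × ℝ => p.2) ((convPow ρ n).prod ρ) :=
      indepFun_prod measurable_id measurable_id
    refine ⟨?_, ?_, ?_⟩
    · rw [convPow, Measure.conv, memLp_map_measure_iff aestronglyMeasurable_id hm.aemeasurable]
      exact hf.add hs
    · rw [convPow, Measure.conv, integral_map hm.aemeasurable (by fun_prop),
        integral_add (hf.integrable (by norm_num)) (hs.integrable (by norm_num)),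
        integral_fun_fst (fun x => x), integral_fun_snd (fun x => x), h2]
      simp
      ring
    · rw [convPow, Measure.conv, variance_id_map hm.aemeasurable]
      change Var[(fun p : ℝ × ℝ => p.1) + (fun p : ℝ × ℝ => p.2); _] = _
      rw [hi.variance_add hf hs]
      have e1 : Var[fun p : ℝ × ℝ => p.1; (convPow ρ n).prod ρ] = Var[id; convPow ρ n] := by
        rw [← variance_id_map measurable_fst.aemeasurable,
          (measurePreserving_fst (μ := convPow ρ n) (ν := ρ)).map_eq]
      have e2 : Var[fun p : ℝ × ℝ => p.2; (convPow ρ n).prod ρ] = Var[id; ρ] := by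
        rw [← variance_id_map measurable_snd.aemeasurable,
          (measurePreserving_snd (μ := convPow ρ n) (ν := ρ)).map_eq]
      rw [e1, e2, h3]
      push_cast
      ring

/-- Chebyshev's inequality: the variance grows like `n`, the squared half-width like `n ^ 2`, so
`hV` leaves at most half of the mass outside the window. -/
theorem half_le_convPow_Icc {ρ : Measure ℝ} [IsProbabilityMeasure ρ] (h : MemLp id 2 ρ)
    {δ : ℝ} (hδ : 0 < δ) {n : ℕ} (hn : 1 ≤ n) (hV : 2 * Var[id; ρ] ≤ n * δ ^ 2) :
    ENNReal.ofReal (1 / 2) ≤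
      convPow ρ n (Set.Icc (n * (∫ x, x ∂ρ - δ)) (n * (∫ x, x ∂ρ + δ))) := by
  obtain ⟨h1, h2, h3⟩ := moments_convPow h n
  have hn0 : (0 : ℝ) < n := by exact_mod_cast hn
  have hc := meas_ge_le_variance_div_sq h1 (mul_pos hn0 hδ)
  have hb : Var[id; convPow ρ n] / (n * δ) ^ 2 ≤ 1 / 2 := by
    rw [h3, div_le_iff₀ (by positivity)]
    nlinarith
  have hc' := hc.trans (ENNReal.ofReal_le_ofReal hb)
  have hcompl : (Set.Icc (n * (∫ x, x ∂ρ - δ)) (n * (∫ x, x ∂ρ + δ)))ᶜ ⊆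
      {x | n * δ ≤ |id x - ∫ y, id y ∂convPow ρ n|} := by
    intro x hx
    simp only [id, h2, Set.mem_ofPred_eq, Set.mem_compl_iff, Set.mem_Icc, not_and_or, not_le] at hx ⊢
    rcases hx with hx | hx
    · rw [le_abs]; right; linarith
    · rw [le_abs]; left; linarith
  have hle := (measure_mono hcompl).trans hc'
  rw [prob_compl_eq_one_sub measurableSet_Icc, tsub_le_iff_left] at hle
  have e : (1 : ENNReal) = ENNReal.ofReal (1 / 2) + ENNReal.ofReal (1 / 2) := by
    rw [← ENNReal.ofReal_add (by norm_num) (by norm_num)]; norm_num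
  rw [e] at hle
  exact (ENNReal.add_le_add_iff_right ENNReal.ofReal_ne_top).1 hle

/-- Exponential tilting commutes with convolution powers. -/
theorem lintegral_convPow_tilted {ν : Measure ℝ} [IsProbabilityMeasure ν] (h : ExpIntegrable ν)
    (l : ℝ) (n : ℕ) {f : ℝ → ENNReal} (hf : Measurable f) :
    ENNReal.ofReal (mgf id ν l ^ n) * ∫⁻ x, f x ∂convPow (ν.tilted (fun x => l * x)) n =
      ∫⁻ x, ENNReal.ofReal (Real.exp (l * x)) * f x ∂convPow ν n := by
  have hpos : 0 < mgf id ν l := mgf_pos (h l)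
  have : IsProbabilityMeasure (ν.tilted (fun x => l * x)) := isProbabilityMeasure_tilted (h l)
  -- The induction must vary `f`: its hypothesis is applied to the function of `x` obtained by
  -- integrating `exp (l * y) * f (x + y)` over the last summand `y`.
  induction n generalizing f with
  | zero => simp [convPow, lintegral_dirac' _ hf]
  | succ n ih =>
    have hF : Measurable fun p : ℝ × ℝ =>
        ENNReal.ofReal (Real.exp (l * p.2)) * f (p.1 + p.2) := by fun_prop
    have key : ∀ x, ENNReal.ofReal (mgf id ν l) * ∫⁻ y, f (x + y) ∂ν.tilted (fun x => l * x) =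
        ∫⁻ y, ENNReal.ofReal (Real.exp (l * y)) * f (x + y) ∂ν := by
      intro x
      rw [lintegral_tilted, ← lintegral_const_mul _ (by fun_prop)]
      refine lintegral_congr fun y => ?_
      rw [← mul_assoc, ← ENNReal.ofReal_mul hpos.le]
      congr 2
      exact mul_div_cancel₀ _ hpos.ne'
    rw [convPow, convPow, Measure.lintegral_conv hf, Measure.lintegral_conv (by fun_prop),
      pow_succ, ENNReal.ofReal_mul (by positivity), mul_assoc, ← lintegral_const_mul _ (by
        exact Measurable.lintegral_prod_right' (f := fun p : ℝ × ℝ => f (p.1 + p.2))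
          (by fun_prop))]
    simp_rw [key]
    rw [ih (Measurable.lintegral_prod_right' hF)]
    refine lintegral_congr fun x => ?_
    rw [← lintegral_const_mul _ (by fun_prop)]
    refine lintegral_congr fun y => ?_
    rw [mul_add, Real.exp_add, ENNReal.ofReal_mul (Real.exp_pos _).le, mul_assoc]

theorem ExpIntegrable.integrableExpSet {μ : Measure ℝ} (h : ExpIntegrable μ) :
    integrableExpSet id μ = Set.univ :=
  Set.eq_univ_of_forall fun l => h l

theorem ExpIntegrable.mem_interior {μ : Measure ℝ} (h : ExpIntegrable μ) (l : ℝ) :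
    l ∈ interior (ProbabilityTheory.integrableExpSet id μ) := by
  rw [h.integrableExpSet, interior_univ]
  trivial

/-- The lower bound in Cramér's theorem, by tilting and Chebyshev's inequality. -/
theorem cramer_lower_convPow {ν : Measure ℝ} [IsProbabilityMeasure ν] (h : ExpIntegrable ν)
    {l : ℝ} (hl : 0 ≤ l) {δ : ℝ} (hδ : 0 < δ) {n : ℕ} (hn : 1 ≤ n)
    (hV : 2 * iteratedDeriv 2 (cgf id ν) l ≤ n * δ ^ 2) :
    ENNReal.ofReal (mgf id ν l ^ n / 2) ≤
      ENNReal.ofReal (Real.exp (l * (n * (deriv (cgf id ν) l + δ)))) *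
        convPow ν n (Set.Ici (n * (deriv (cgf id ν) l - δ))) := by
  have : IsProbabilityMeasure (ν.tilted (fun x => l * x)) := isProbabilityMeasure_tilted (h l)
  have hpos : 0 < mgf id ν l := mgf_pos (h l)
  have hmean : ∫ x, x ∂ν.tilted (fun x => l * x) = deriv (cgf id ν) l :=
    integral_tilted_mul_self (X := id) (h.mem_interior l)
  have hvar : Var[id; ν.tilted (fun x => l * x)] = iteratedDeriv 2 (cgf id ν) l :=
    variance_tilted_mul (X := id) (h.mem_interior l)
  have hmem : MemLp id 2 (ν.tilted (fun x => l * x)) :=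
    memLp_tilted_mul (X := id) (h.mem_interior l) 2
  have hhalf := half_le_convPow_Icc hmem hδ hn (by rwa [hvar])
  rw [hmean] at hhalf
  set A := Set.Icc (n * (deriv (cgf id ν) l - δ)) (n * (deriv (cgf id ν) l + δ)) with hA
  have hAm : MeasurableSet A := measurableSet_Icc
  rw [div_eq_mul_one_div, ENNReal.ofReal_mul (by positivity)]
  calc _ ≤ ENNReal.ofReal (mgf id ν l ^ n) * convPow (ν.tilted (fun x => l * x)) n A := by gcongr
    _ = ∫⁻ x, ENNReal.ofReal (Real.exp (l * x)) * A.indicator 1 x ∂convPow ν n := by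
      rw [← lintegral_convPow_tilted h l n (measurable_one.indicator hAm),
        lintegral_indicator_one hAm]
    _ ≤ ∫⁻ x, ENNReal.ofReal (Real.exp (l * (n * (deriv (cgf id ν) l + δ)))) *
          A.indicator 1 x ∂convPow ν n := by
      -- As `0 ≤ l`, the weight `exp (l * x)` on the window is at most its value at the right
      -- endpoint.
      refine lintegral_mono fun x => ?_
      by_cases hx : x ∈ A
      · have := hx.2
        gcongr
      · simp [hx]
    _ = ENNReal.ofReal (Real.exp (l * (n * (deriv (cgf id ν) l + δ)))) * convPow ν n A := by
      rw [lintegral_const_mul _ (measurable_one.indicator hAm), lintegral_indicator_one hAm]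
    _ ≤ _ := by
      gcongr
      exact Set.Icc_subset_Ici_self

/-- Comparison of upper tails with the same tilting parameter on both sides. -/
theorem convPow_Ici_le_of_cgf {μ ν : Measure ℝ} [IsProbabilityMeasure μ] [IsProbabilityMeasure ν]
    (hμ : ExpIntegrable μ) (hν : ExpIntegrable ν) {l : ℝ} (hl : 0 ≤ l) {δ : ℝ} (hδ : 0 < δ)
    {n : ℕ} (hn : 1 ≤ n) (hV : 2 * iteratedDeriv 2 (cgf id ν) l ≤ n * δ ^ 2) {x : ℝ}
    (hx : Real.log 2 ≤
      n * (cgf id ν l - cgf id μ l - l * (deriv (cgf id ν) l + δ - x))) :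
    convPow μ n (Set.Ici (n * x)) ≤ convPow ν n (Set.Ici (n * (deriv (cgf id ν) l - δ))) := by
  set y := deriv (cgf id ν) l
  have h1 := chernoff_convPow hμ hl n (n * x)
  have h2 := cramer_lower_convPow hν hl hδ hn hV
  have hM : ∀ {κ : Measure ℝ} [IsProbabilityMeasure κ], ExpIntegrable κ →
      mgf id κ l ^ n = Real.exp (n * cgf id κ l) := by
    intro κ _ hκ
    rw [Real.exp_nat_mul, exp_cgf (X := id) (hκ l)]
  rw [hM hμ] at h1
  rw [hM hν] at h2
  -- The `log 2` is the price of the factor one half from Chebyshev's inequality.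
  have hlog : Real.exp (n * cgf id ν l) / 2 = Real.exp (n * cgf id ν l - Real.log 2) := by
    rw [Real.exp_sub, Real.exp_log two_pos]
  rw [hlog] at h2
  have move : ∀ a : ℝ, ∀ z : ENNReal,
      ENNReal.ofReal (Real.exp (-a)) * (ENNReal.ofReal (Real.exp a) * z) = z := by
    intro a z
    rw [← mul_assoc, ← ENNReal.ofReal_mul (Real.exp_pos _).le, ← Real.exp_add]
    simp
  calc _ = ENNReal.ofReal (Real.exp (-(l * (n * x)))) * _ := (move (l * (n * x)) _).symm
    _ ≤ ENNReal.ofReal (Real.exp (-(l * (n * x)))) * ENNReal.ofReal (Real.exp (n * cgf id μ l)) := by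
      gcongr
    _ = ENNReal.ofReal (Real.exp (n * cgf id μ l - l * (n * x))) := by
      rw [← ENNReal.ofReal_mul (Real.exp_pos _).le, ← Real.exp_add]
      ring_nf
    _ ≤ ENNReal.ofReal (Real.exp (n * cgf id ν l - Real.log 2 - l * (n * (y + δ)))) := by
      apply ENNReal.ofReal_le_ofReal
      apply Real.exp_le_exp.2
      nlinarith
    _ = ENNReal.ofReal (Real.exp (-(l * (n * (y + δ))))) *
          ENNReal.ofReal (Real.exp (n * cgf id ν l - Real.log 2)) := by
      rw [← ENNReal.ofReal_mul (Real.exp_pos _).le, ← Real.exp_add]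
      ring_nf
    _ ≤ _ := by gcongr
    _ = _ := move _ _

/-! ### Comparison of the tails of large convolution powers -/

theorem ExpIntegrable.analyticOnNhd_cgf {μ : Measure ℝ} [IsProbabilityMeasure μ]
    (h : ExpIntegrable μ) : AnalyticOnNhd ℝ (cgf id μ) Set.univ := by
  have := ProbabilityTheory.analyticOnNhd_cgf (X := id) (μ := μ)
  rwa [h.integrableExpSet, interior_univ] at this

theorem ExpIntegrable.differentiable_cgf {μ : Measure ℝ} [IsProbabilityMeasure μ]
    (h : ExpIntegrable μ) : Differentiable ℝ (cgf id μ) :=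
  fun l => (h.analyticOnNhd_cgf l trivial).differentiableAt

theorem ExpIntegrable.continuous_deriv_cgf {μ : Measure ℝ} [IsProbabilityMeasure μ]
    (h : ExpIntegrable μ) : Continuous (deriv (cgf id μ)) :=
  continuousOn_univ.1 h.analyticOnNhd_cgf.deriv.continuousOn

theorem ExpIntegrable.continuous_iteratedDeriv_two_cgf {μ : Measure ℝ} [IsProbabilityMeasure μ]
    (h : ExpIntegrable μ) : Continuous (iteratedDeriv 2 (cgf id μ)) := by
  rw [iteratedDeriv_eq_iterate]
  exact continuousOn_univ.1 (h.analyticOnNhd_cgf.iterated_deriv 2).continuousOn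

theorem ExpIntegrable.hasDerivAt_cgf_zero {μ : Measure ℝ} [IsProbabilityMeasure μ]
    (h : ExpIntegrable μ) : HasDerivAt (cgf id μ) (∫ x, x ∂μ) 0 := by
  have := (h.differentiable_cgf 0).hasDerivAt
  rw [deriv_cgf_zero (h.mem_interior 0)] at this
  simpa using this

/-- Chernoff's bound read backwards: mass beyond `c` forces the log-Laplace transform to grow with
slope at least `c`. -/
theorem ExpIntegrable.le_cgf {ν : Measure ℝ} [IsProbabilityMeasure ν] (h : ExpIntegrable ν)
    {c : ℝ} (hc : ν (Set.Ici c) ≠ 0) {l : ℝ} (hl : 0 ≤ l) :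
    l * c + Real.log (ν.real (Set.Ici c)) ≤ cgf id ν l := by
  have hp : 0 < ν.real (Set.Ici c) := ENNReal.toReal_pos hc (measure_ne_top _ _)
  have := measure_ge_le_exp_cgf (X := id) c hl (h l)
  have h2 := Real.log_le_log hp this
  rw [Real.log_exp] at h2
  linarith

theorem ExpIntegrable.exists_lt_deriv_cgf {ν : Measure ℝ} [IsProbabilityMeasure ν]
    (h : ExpIntegrable ν) {b c : ℝ} (hc : ν (Set.Ici c) ≠ 0) (hbc : b < c) {l : ℝ} (hl : 0 ≤ l) :
    ∃ L, l < L ∧ b < deriv (cgf id ν) L := by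
  -- Chosen so that `q < T * (c - b)` makes the slope of `cgf id ν` over `[l, T]` exceed `b`; the
  -- mean value theorem then supplies the tilt.
  set q := cgf id ν l - Real.log (ν.real (Set.Ici c)) - b * l with hq
  obtain ⟨T, hT⟩ := exists_gt (max l (q / (c - b)))
  have hT1 : l < T := (le_max_left _ _).trans_lt hT
  have hT2 : q / (c - b) < T := (le_max_right _ _).trans_lt hT
  rw [div_lt_iff₀ (sub_pos.2 hbc)] at hT2
  obtain ⟨ξ, hξ, hd⟩ := exists_deriv_eq_slope (cgf id ν) hT1
    h.differentiable_cgf.continuous.continuousOn h.differentiable_cgf.differentiableOn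
  refine ⟨ξ, hξ.1, ?_⟩
  rw [hd, lt_div_iff₀ (sub_pos.2 hT1)]
  have := h.le_cgf hc (hl.trans hT1.le)
  nlinarith

/-- Divided by `l`, the expression tends to `x₀ - ∫ x, x ∂μ` as `l` decreases to `0`, since the mean
of `ν` cancels. This one tilt handles the thresholds near `x₀`, where the optimal tilt could
degenerate to `0`. -/
theorem exists_pos_tilt {μ ν : Measure ℝ} [IsProbabilityMeasure μ] [IsProbabilityMeasure ν]
    (hμ : ExpIntegrable μ) (hν : ExpIntegrable ν) {x₀ : ℝ} (hx₀ : ∫ x, x ∂μ < x₀) :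
    ∃ l, 0 < l ∧ 0 < cgf id ν l - cgf id μ l - l * (deriv (cgf id ν) l - x₀) := by
  have h1 := (hν.hasDerivAt_cgf_zero.sub hμ.hasDerivAt_cgf_zero).tendsto_slope_zero_right
  have h2 : Filter.Tendsto (deriv (cgf id ν)) (𝓝[>] 0) (𝓝 (∫ x, x ∂ν)) := by
    have := (hν.continuous_deriv_cgf.tendsto 0).mono_left (nhdsWithin_le_nhds (s := Set.Ioi 0))
    rwa [hν.hasDerivAt_cgf_zero.deriv] at this
  have h3 := (h1.sub (h2.sub_const x₀)).eventually (lt_mem_nhds (a := 0) (by linarith))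
  obtain ⟨l, hl, hl0⟩ := (h3.and self_mem_nhdsWithin).exists
  have hl0 : 0 < l := hl0
  refine ⟨l, hl0, ?_⟩
  simp only [zero_add, Pi.sub_apply, cgf_zero, sub_zero, smul_eq_mul] at hl
  have := mul_pos hl0 hl
  rw [mul_sub, ← mul_assoc, mul_inv_cancel₀ hl0.ne', one_mul] at this
  exact this

/-- Strict domination of Laplace transforms forces domination of the upper tails of all large
convolution powers. -/
theorem exists_convPow_Ici_le {μ ν : Measure ℝ} [IsProbabilityMeasure μ] [IsProbabilityMeasure ν]
    (hμ : ExpIntegrable μ) (hν : ExpIntegrable ν) {b c : ℝ} (hb : μ (Set.Ioi b) = 0)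
    (hc : ν (Set.Ici c) ≠ 0) (hbc : b < c) (hlt : ∀ l, 0 < l → mgf id μ l < mgf id ν l)
    {x₀ : ℝ} (hx₀ : ∫ x, x ∂μ < x₀) :
    ∃ N : ℕ, ∀ n : ℕ, N ≤ n → ∀ x, x₀ ≤ x →
      convPow μ n (Set.Ici (n * x)) ≤ convPow ν n (Set.Ici (n * x)) := by
  set ψ := cgf id ν with hψ
  set φ := cgf id μ with hφ
  have hg : ∀ l, 0 < l → 0 < ψ l - φ l := fun l hl =>
    sub_pos.2 (Real.log_lt_log (mgf_pos (hμ l)) (hlt l hl))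
  obtain ⟨l₀, hl₀, hη⟩ := exists_pos_tilt hμ hν hx₀
  obtain ⟨L, hL, hbL⟩ := hν.exists_lt_deriv_cgf hc hbc hl₀.le
  have hL0 : 0 < L := hl₀.trans hL
  obtain ⟨m, hm, hmin⟩ := (isCompact_Icc (a := l₀) (b := L)).exists_isMinOn
    (Set.nonempty_Icc.2 hL.le)
    (hν.differentiable_cgf.continuous.sub hμ.differentiable_cgf.continuous).continuousOn
  set γ := ψ m - φ m with hγ
  have hγ0 : 0 < γ := hg m (hl₀.trans_le hm.1)
  obtain ⟨V, hV⟩ := (isCompact_Icc (a := l₀) (b := L)).bddAbove_image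
    hν.continuous_iteratedDeriv_two_cgf.continuousOn
  set η := ψ l₀ - φ l₀ - l₀ * (deriv ψ l₀ - x₀) with hηd
  -- The three bounds serve the three ranges of `x` below: the loss `l₀ * δ` stays under `η / 2`,
  -- the loss `2 * l * δ` under `γ / 2` for `l ≤ L`, and `deriv ψ L - δ` stays above `b`.
  obtain ⟨δ, hδ, hδs⟩ : ∃ δ : ℝ, 0 < δ ∧
      δ < η / (2 * l₀) ∧ δ < γ / (4 * L) ∧ δ < deriv ψ L - b := by
    have hpos : 0 < min (η / (2 * l₀)) (min (γ / (4 * L)) (deriv ψ L - b)) :=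
      lt_min (by positivity) (lt_min (by positivity) (sub_pos.2 hbL))
    obtain ⟨δ, h0, h1⟩ := exists_between hpos
    exact ⟨δ, h0, by simpa [lt_min_iff] using h1⟩
  obtain ⟨hδ1, hδ2, hδ3⟩ := hδs
  rw [lt_div_iff₀ (by positivity)] at hδ1 hδ2
  have hlarge : ∀ᶠ n : ℕ in Filter.atTop, 1 ≤ n ∧ 2 * V ≤ n * δ ^ 2 ∧
      Real.log 2 ≤ n * (η / 2) ∧ Real.log 2 ≤ n * (γ / 2) := by
    have key : ∀ a r : ℝ, 0 < r → ∀ᶠ n : ℕ in Filter.atTop, a ≤ n * r := fun a r hr =>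
      (tendsto_natCast_atTop_atTop.atTop_mul_const hr).eventually_ge_atTop a
    filter_upwards [Filter.eventually_ge_atTop 1, key (2 * V) (δ ^ 2) (by positivity),
      key (Real.log 2) (η / 2) (by positivity), key (Real.log 2) (γ / 2) (by positivity)]
      with n h1 h2 h3 h4 using ⟨h1, h2, h3, h4⟩
  obtain ⟨N, hN⟩ := Filter.eventually_atTop.1 hlarge
  refine ⟨N, fun n hn x hx => ?_⟩
  obtain ⟨hn1, hnV, hnη, hnγ⟩ := hN n hn
  have hn0 : (0 : ℝ) < n := by exact_mod_cast hn1
  have hVl : ∀ l ∈ Set.Icc l₀ L, 2 * iteratedDeriv 2 ψ l ≤ n * δ ^ 2 := fun l hl =>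
    (mul_le_mul_of_nonneg_left (hV (Set.mem_image_of_mem _ hl)) two_pos.le).trans hnV
  rcases le_total x (deriv ψ l₀ - δ) with h1 | h1
  · calc convPow μ n (Set.Ici (n * x)) ≤ convPow μ n (Set.Ici (n * x₀)) := by gcongr
      _ ≤ convPow ν n (Set.Ici (n * (deriv ψ l₀ - δ))) := by
        refine convPow_Ici_le_of_cgf hμ hν hl₀.le hδ hn1 (hVl l₀ ⟨le_rfl, hL.le⟩)
          (hnη.trans (mul_le_mul_of_nonneg_left ?_ hn0.le))
        change η / 2 ≤ ψ l₀ - φ l₀ - l₀ * (deriv ψ l₀ + δ - x₀)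
        linarith
      _ ≤ _ := by gcongr
  rcases le_total x (deriv ψ L - δ) with h2 | h2
  -- The tilt aims at `x + δ`, so that the left end of the Cramér window is exactly `x`.
  · obtain ⟨l, hl, hlx⟩ := intermediate_value_Icc hL.le
      (hν.continuous_deriv_cgf.continuousOn (s := Set.Icc l₀ L))
      (show x + δ ∈ Set.Icc (deriv ψ l₀) (deriv ψ L) from ⟨by linarith, by linarith⟩)
    have hlpos : 0 < l := hl₀.trans_le hl.1
    have hres := convPow_Ici_le_of_cgf hμ hν hlpos.le hδ hn1 (hVl l hl) (x := x)
      (hnγ.trans (mul_le_mul_of_nonneg_left ?_ hn0.le))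
    · rw [hlx] at hres
      simpa using hres
    · have h3 : γ ≤ ψ l - φ l := hmin hl
      have h4 : l * δ ≤ L * δ := by gcongr; exact hl.2
      rw [hlx]
      change γ / 2 ≤ ψ l - φ l - l * (x + δ + δ - x)
      linarith
  · have : convPow μ n (Set.Ici (n * x)) ≤ convPow μ n (Set.Ioi (n * b)) := by
      apply measure_mono
      intro z hz
      have hz : n * x ≤ z := hz
      have : n * b < n * x := by gcongr; linarith
      exact this.trans_le hz
    rw [convPow_Ioi_eq_zero hb] at this
    exact this.trans zero_le

/-! ### Reflection -/

theorem convPow_map_neg (μ : Measure ℝ) [IsProbabilityMeasure μ] (n : ℕ) :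
    convPow (μ.map Neg.neg) n = (convPow μ n).map Neg.neg := by
  have : IsProbabilityMeasure (μ.map Neg.neg) := Measure.isProbabilityMeasure_map (by fun_prop)
  induction n with
  | zero => simp [convPow]
  | succ n ih =>
    rw [convPow, convPow, ih]
    exact (Measure.map_conv_addMonoidHom (negAddMonoidHom : ℝ →+ ℝ) measurable_neg).symm

theorem ExpIntegrable.map_neg {μ : Measure ℝ} (h : ExpIntegrable μ) :
    ExpIntegrable (μ.map Neg.neg) := by
  intro l
  rw [integrable_map_measure (by fun_prop) (by fun_prop)]
  simpa [Function.comp_def] using h (-l)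

theorem mgf_map_neg (μ : Measure ℝ) (l : ℝ) : mgf id (μ.map Neg.neg) l = mgf id μ (-l) := by
  rw [mgf_id_map (by fun_prop)]
  simp [mgf]

/-- Reflection and complementation exchange closed and open half-lines; continuity from below passes
between them. -/
theorem measure_Ioi_le_of_measure_Ici_le {μ ν : Measure ℝ} {s : ℝ}
    (h : ∀ t, s ≤ t → μ (Set.Ici t) ≤ ν (Set.Ici t)) {t : ℝ} (ht : s ≤ t) :
    μ (Set.Ioi t) ≤ ν (Set.Ioi t) := by
  have hU : Set.Ioi t = ⋃ k : ℕ, Set.Ici (t + 1 / ((k : ℝ) + 1)) := by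
    ext z
    simp only [Set.mem_Ioi, Set.mem_iUnion, Set.mem_Ici]
    constructor
    · intro hz
      obtain ⟨k, hk⟩ := exists_nat_one_div_lt (sub_pos.2 hz)
      exact ⟨k, by linarith⟩
    · rintro ⟨k, hk⟩
      have : 0 < 1 / ((k : ℝ) + 1) := by positivity
      linarith
  have hmono : Monotone fun k : ℕ => Set.Ici (t + 1 / ((k : ℝ) + 1)) := by
    intro i j hij
    apply Set.Ici_subset_Ici.2
    gcongr
  rw [hU, hmono.measure_iUnion, hmono.measure_iUnion]
  refine iSup_mono fun k => h _ ?_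
  have : 0 < 1 / ((k : ℝ) + 1) := by positivity
  linarith

theorem stLE_of_Ici_le_of_reflect {μ ν : Measure ℝ} [IsProbabilityMeasure μ]
    [IsProbabilityMeasure ν] {s : ℝ} (h1 : ∀ t, s ≤ t → μ (Set.Ici t) ≤ ν (Set.Ici t))
    (h2 : ∀ t, -s ≤ t → ν.map Neg.neg (Set.Ici t) ≤ μ.map Neg.neg (Set.Ici t)) :
    StLE μ ν := by
  intro t
  rcases le_total s t with h | h
  · exact h1 t h
  have key := measure_Ioi_le_of_measure_Ici_le h2 (neg_le_neg h)
  rw [Measure.map_apply measurable_neg measurableSet_Ioi,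
    Measure.map_apply measurable_neg measurableSet_Ioi] at key
  change ν (-Set.Ioi (-t)) ≤ μ (-Set.Ioi (-t)) at key
  rw [Set.neg_Ioi, neg_neg] at key
  rw [← Set.compl_Iio, prob_compl_eq_one_sub measurableSet_Iio,
    prob_compl_eq_one_sub measurableSet_Iio]
  exact tsub_le_tsub_left key 1

theorem StLE.map_neg {μ ν : Measure ℝ} [IsProbabilityMeasure μ] [IsProbabilityMeasure ν]
    (h : StLE μ ν) : StLE (ν.map Neg.neg) (μ.map Neg.neg) := by
  intro t
  rw [Measure.map_apply measurable_neg measurableSet_Ici,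
    Measure.map_apply measurable_neg measurableSet_Ici]
  change ν (-Set.Ici t) ≤ μ (-Set.Ici t)
  rw [Set.neg_Ici, ← Set.compl_Ioi, prob_compl_eq_one_sub measurableSet_Ioi,
    prob_compl_eq_one_sub measurableSet_Ioi]
  exact tsub_le_tsub_left (measure_Ioi_le_of_measure_Ici_le (fun t _ => h t) le_rfl) 1

/-- Two measures with strictly ordered Laplace transforms, means and essential bounds are
comparable after taking a convolution power. -/
theorem stLEStar_of_strict {μ ν : Measure ℝ} [IsProbabilityMeasure μ] [IsProbabilityMeasure ν]
    (hμ : ExpIntegrable μ) (hν : ExpIntegrable ν)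
    {b c b' c' : ℝ} (hb : μ (Set.Ioi b) = 0) (hc : ν (Set.Ici c) ≠ 0) (hbc : b < c)
    (hb' : ν (Set.Iio b') = 0) (hc' : μ (Set.Iic c') ≠ 0) (hbc' : c' < b')
    (hpos : ∀ l, 0 < l → mgf id μ l < mgf id ν l) (hneg : ∀ l, l < 0 → mgf id ν l < mgf id μ l)
    (hmean : ∫ x, x ∂μ < ∫ x, x ∂ν) : StLEStar μ ν := by
  -- A point strictly between the means splits the line: upper tails are compared above `n * x₀`,
  -- and the reflected measures, whose means are also strictly ordered around `-x₀`, handle the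
  -- rest.
  obtain ⟨x₀, hx1, hx2⟩ := exists_between hmean
  have : IsProbabilityMeasure (μ.map Neg.neg) := Measure.isProbabilityMeasure_map (by fun_prop)
  have : IsProbabilityMeasure (ν.map Neg.neg) := Measure.isProbabilityMeasure_map (by fun_prop)
  obtain ⟨N, hN⟩ := exists_convPow_Ici_le hμ hν hb hc hbc hpos hx1
  obtain ⟨N', hN'⟩ := exists_convPow_Ici_le (b := -b') (c := -c') (x₀ := -x₀)
    hν.map_neg hμ.map_neg
    (by rw [Measure.map_apply measurable_neg measurableSet_Ioi]; simpa using hb')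
    (by rw [Measure.map_apply measurable_neg measurableSet_Ici]; simpa using hc')
    (by linarith) (fun l hl => by
      rw [mgf_map_neg, mgf_map_neg]
      exact hneg _ (by linarith))
    (by rw [integral_map (by fun_prop) (by fun_prop), integral_neg]; linarith)
  set n := max 1 (max N N') with hn
  have hn1 : 1 ≤ n := le_max_left _ _
  have hn0 : (0 : ℝ) < n := by exact_mod_cast hn1
  refine ⟨n, hn1, stLE_of_Ici_le_of_reflect (s := n * x₀) ?_ ?_⟩
  · intro t ht
    have := hN n (by omega) (t / n) (by rw [le_div_iff₀ hn0]; linarith)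
    rwa [mul_div_cancel₀ _ hn0.ne'] at this
  · intro t ht
    have := hN' n (by omega) (t / n) (by rw [le_div_iff₀ hn0]; linarith)
    rwa [mul_div_cancel₀ _ hn0.ne', convPow_map_neg, convPow_map_neg] at this

/-! ### Subexponential functions -/

theorem Subexponential.exists_nonneg {f : ℝ → ℝ} (hf : Subexponential f) :
    ∃ c C : ℝ, 0 ≤ c ∧ 0 ≤ C ∧ ∀ x, |f x| ≤ C * Real.exp (c * |x|) := by
  obtain ⟨c, C, h⟩ := hf
  refine ⟨|c|, |C|, abs_nonneg _, abs_nonneg _, fun x => (h x).trans ?_⟩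
  gcongr
  · exact le_abs_self C
  · exact le_abs_self c

theorem ExpIntegrable.integrable {μ : Measure ℝ} (h : ExpIntegrable μ) {f : ℝ → ℝ}
    (hc : Continuous f) (hf : Subexponential f) : Integrable f μ :=
  integrable_testFun ⟨μ, h⟩ ⟨f, hc, hf⟩

theorem subexponential_exp (l : ℝ) : Subexponential fun x => Real.exp (l * x) := by
  refine ⟨|l|, 1, fun x => ?_⟩
  rw [abs_of_pos (Real.exp_pos _), one_mul, ← abs_mul]
  exact Real.exp_le_exp.2 (le_abs_self _)

theorem subexponential_exp_abs (l : ℝ) : Subexponential fun x => Real.exp (l * |x|) :=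
  ⟨l, 1, fun x => by rw [abs_of_pos (Real.exp_pos _), one_mul]⟩

theorem subexponential_id : Subexponential fun x => x := by
  refine ⟨1, 1, fun x => ?_⟩
  linarith [Real.add_one_le_exp (1 * |x|)]

/-- Used for truncations (`a = 0`) and shifted truncations, where the shift only costs the factor
`exp (c * a)`. -/
theorem Subexponential.comp {f g : ℝ → ℝ} (hf : Subexponential f) {a : ℝ}
    (hg : ∀ x, |g x| ≤ |x| + a) : Subexponential fun x => f (g x) := by
  obtain ⟨c, C, hc, hC, h⟩ := hf.exists_nonneg
  refine ⟨c, C * Real.exp (c * a), fun x => (h _).trans ?_⟩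
  rw [mul_assoc, ← Real.exp_add, ← mul_add]
  gcongr
  linarith [hg x]

/-! ### Approximation from below -/

/-- The law of `min X k - ξ`, where `ξ` is independent of `X` and equals `2 * k + 1` with
probability `exp (-k ^ 2)` and `0` otherwise. -/
noncomputable def lowerApprox (μ : Measure ℝ) (k : ℕ) : Measure ℝ :=
  ENNReal.ofReal (1 - Real.exp (-(k : ℝ) ^ 2)) • μ.map (fun x : ℝ => min x k) +
    ENNReal.ofReal (Real.exp (-(k : ℝ) ^ 2)) • μ.map (fun x : ℝ => min x k - (2 * k + 1))

theorem exp_neg_sq_le_one (k : ℕ) : Real.exp (-(k : ℝ) ^ 2) ≤ 1 :=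
  Real.exp_le_one_iff.2 (neg_nonpos.2 (sq_nonneg _))

instance isProbabilityMeasure_lowerApprox (μ : Measure ℝ) [IsProbabilityMeasure μ] (k : ℕ) :
    IsProbabilityMeasure (lowerApprox μ k) := by
  constructor
  have h1 : IsProbabilityMeasure (μ.map fun x : ℝ => min x k) :=
    Measure.isProbabilityMeasure_map (by fun_prop)
  have h2 : IsProbabilityMeasure (μ.map fun x : ℝ => min x k - (2 * k + 1)) :=
    Measure.isProbabilityMeasure_map (by fun_prop)
  simp only [lowerApprox, Measure.coe_add, Measure.coe_smul, Pi.add_apply, Pi.smul_apply,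
    measure_univ, smul_eq_mul, mul_one]
  rw [← ENNReal.ofReal_add (sub_nonneg.2 (exp_neg_sq_le_one k)) (Real.exp_pos _).le]
  simp

theorem abs_min_natCast_le (x : ℝ) (k : ℕ) : |min x k| ≤ |x| := by
  have hk : (0 : ℝ) ≤ k := k.cast_nonneg
  rcases min_cases x (k : ℝ) with ⟨h, h'⟩ | ⟨h, h'⟩ <;> rw [h]
  rw [abs_of_nonneg hk]
  exact h'.le.trans (le_abs_self x)

theorem abs_min_natCast_sub_le (x : ℝ) (k : ℕ) :
    |min x k - (2 * k + 1)| ≤ |x| + (2 * k + 1) := by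
  refine (abs_sub _ _).trans ?_
  rw [abs_of_nonneg (show (0 : ℝ) ≤ 2 * k + 1 by positivity)]
  linarith [abs_min_natCast_le x k]

theorem ExpIntegrable.integrable_min {μ : Measure ℝ} (h : ExpIntegrable μ) {f : ℝ → ℝ}
    (hc : Continuous f) (hf : Subexponential f) (k : ℕ) :
    Integrable (fun x : ℝ => f (min x k)) μ :=
  h.integrable (by fun_prop)
    (hf.comp (a := 0) fun x => by simpa using abs_min_natCast_le x k)

theorem ExpIntegrable.integrable_min_sub {μ : Measure ℝ} (h : ExpIntegrable μ) {f : ℝ → ℝ}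
    (hc : Continuous f) (hf : Subexponential f) (k : ℕ) :
    Integrable (fun x : ℝ => f (min x k - (2 * k + 1))) μ :=
  h.integrable (by fun_prop) (hf.comp fun x => abs_min_natCast_sub_le x k)

theorem ExpIntegrable.lowerApprox {μ : Measure ℝ} (h : ExpIntegrable μ) (k : ℕ) :
    ExpIntegrable (StDom.lowerApprox μ k) := by
  intro l
  have hc : Continuous fun x : ℝ => Real.exp (l * x) := by fun_prop
  refine Integrable.add_measure ?_ ?_
  · refine Integrable.smul_measure ?_ ENNReal.ofReal_ne_top
    rw [integrable_map_measure hc.aestronglyMeasurable (by fun_prop)]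
    exact h.integrable_min hc (subexponential_exp l) k
  · refine Integrable.smul_measure ?_ ENNReal.ofReal_ne_top
    rw [integrable_map_measure hc.aestronglyMeasurable (by fun_prop)]
    exact h.integrable_min_sub hc (subexponential_exp l) k

theorem integral_lowerApprox {μ : Measure ℝ} (h : ExpIntegrable μ) {f : ℝ → ℝ}
    (hc : Continuous f) (hf : Subexponential f) (k : ℕ) :
    ∫ x, f x ∂lowerApprox μ k =
      (1 - Real.exp (-(k : ℝ) ^ 2)) * ∫ x, f (min x k) ∂μ +
        Real.exp (-(k : ℝ) ^ 2) * ∫ x, f (min x k - (2 * k + 1)) ∂μ := by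
  have hi := (h.lowerApprox k).integrable hc hf
  rw [lowerApprox] at hi ⊢
  rw [integral_add_measure hi.left_of_add_measure hi.right_of_add_measure,
    integral_smul_measure, integral_smul_measure,
    integral_map (by fun_prop) hc.aestronglyMeasurable,
    integral_map (by fun_prop) hc.aestronglyMeasurable,
    ENNReal.toReal_ofReal (sub_nonneg.2 (exp_neg_sq_le_one k)),
    ENNReal.toReal_ofReal (Real.exp_pos _).le, smul_eq_mul, smul_eq_mul]

theorem lowerApprox_Ioi (μ : Measure ℝ) (k : ℕ) : lowerApprox μ k (Set.Ioi k) = 0 := by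
  have hk : (0 : ℝ) ≤ k := k.cast_nonneg
  have e1 : (fun x : ℝ => min x k) ⁻¹' Set.Ioi k = ∅ := by
    ext x; simp
  have e2 : (fun x : ℝ => min x k - (2 * k + 1)) ⁻¹' Set.Ioi k = ∅ := by
    ext x
    simp only [Set.mem_preimage, Set.mem_Ioi, Set.mem_empty_iff_false, iff_false, not_lt]
    linarith [min_le_right x (k : ℝ)]
  simp [lowerApprox, Measure.map_apply (show Measurable fun x : ℝ => min x k by fun_prop),
    Measure.map_apply (show Measurable fun x : ℝ => min x k - (2 * k + 1) by fun_prop), e1, e2]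

/-- This explains the shift `2 * k + 1`: it carries everything below `k` to below `-k - 1`, strictly
left of `-k`, where `upperApprox` has no mass. -/
theorem lowerApprox_Iic_ne_zero (μ : Measure ℝ) [IsProbabilityMeasure μ] (k : ℕ) :
    lowerApprox μ k (Set.Iic (-k - 1)) ≠ 0 := by
  have e2 : (fun x : ℝ => min x k - (2 * k + 1)) ⁻¹' Set.Iic (-k - 1) = Set.univ := by
    ext x
    simp only [Set.mem_preimage, Set.mem_Iic, Set.mem_univ, iff_true]
    linarith [min_le_right x (k : ℝ)]
  simp [lowerApprox,
    Measure.map_apply (show Measurable fun x : ℝ => min x k - (2 * k + 1) by fun_prop), e2,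
    Real.exp_pos]

/-- Independence factors the transform. The truncation factor gives only weak inequalities; the
factor coming from `ξ` makes them strict for `l ≠ 0`. -/
theorem mgf_lowerApprox {μ : Measure ℝ} (h : ExpIntegrable μ) (k : ℕ) (l : ℝ) :
    mgf id (lowerApprox μ k) l =
      (1 + Real.exp (-(k : ℝ) ^ 2) * (Real.exp (-(l * (2 * k + 1))) - 1)) *
        ∫ x, Real.exp (l * min x k) ∂μ := by
  have e : ∀ x : ℝ, Real.exp (l * (min x k - (2 * k + 1))) =
      Real.exp (-(l * (2 * k + 1))) * Real.exp (l * min x k) := by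
    intro x
    rw [← Real.exp_add]
    ring_nf
  have := integral_lowerApprox h (f := fun x => Real.exp (l * x)) (by fun_prop)
    (subexponential_exp l) k
  simp only [e, integral_const_mul] at this
  simp only [mgf, id]
  rw [this]
  ring

theorem integral_exp_min_pos {μ : Measure ℝ} [IsProbabilityMeasure μ] (h : ExpIntegrable μ)
    (k : ℕ) (l : ℝ) : 0 < ∫ x, Real.exp (l * min x k) ∂μ :=
  integral_exp_pos (h.integrable_min (f := fun x => Real.exp (l * x)) (by fun_prop)
    (subexponential_exp l) k)

theorem mgf_lowerApprox_lt {μ : Measure ℝ} [IsProbabilityMeasure μ] (h : ExpIntegrable μ) (k : ℕ)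
    {l : ℝ} (hl : 0 < l) : mgf id (lowerApprox μ k) l < mgf id μ l := by
  have hle : ∫ x, Real.exp (l * min x k) ∂μ ≤ mgf id μ l := by
    refine integral_mono (h.integrable_min (f := fun x => Real.exp (l * x)) (by fun_prop)
      (subexponential_exp l) k) (h l) fun x => ?_
    exact Real.exp_le_exp.2 (mul_le_mul_of_nonneg_left (min_le_left _ _) hl.le)
  refine lt_of_lt_of_le ?_ hle
  rw [mgf_lowerApprox h]
  refine mul_lt_of_lt_one_left (integral_exp_min_pos h k l) ?_
  have : Real.exp (-(l * (2 * k + 1))) < 1 := by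
    rw [Real.exp_lt_one_iff, neg_lt_zero]
    positivity
  nlinarith [Real.exp_pos (-(k : ℝ) ^ 2)]

theorem lt_mgf_lowerApprox {μ : Measure ℝ} [IsProbabilityMeasure μ] (h : ExpIntegrable μ) (k : ℕ)
    {l : ℝ} (hl : l < 0) : mgf id μ l < mgf id (lowerApprox μ k) l := by
  have hle : mgf id μ l ≤ ∫ x, Real.exp (l * min x k) ∂μ := by
    refine integral_mono (h l) (h.integrable_min (f := fun x => Real.exp (l * x)) (by fun_prop)
      (subexponential_exp l) k) fun x => ?_
    exact Real.exp_le_exp.2 (mul_le_mul_of_nonpos_left (min_le_left _ _) hl.le)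
  refine lt_of_le_of_lt hle ?_
  rw [mgf_lowerApprox h]
  refine lt_mul_of_one_lt_left (integral_exp_min_pos h k l) ?_
  have : 1 < Real.exp (-(l * (2 * k + 1))) :=
    Real.one_lt_exp_iff.2 (neg_pos.2 (mul_neg_of_neg_of_pos hl (by positivity)))
  nlinarith [Real.exp_pos (-(k : ℝ) ^ 2)]

theorem mean_lowerApprox_lt {μ : Measure ℝ} [IsProbabilityMeasure μ] (h : ExpIntegrable μ)
    (k : ℕ) : ∫ x, x ∂lowerApprox μ k < ∫ x, x ∂μ := by
  have hi := h.integrable_min (f := fun x => x) (by fun_prop) subexponential_id k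
  have hle : ∫ x, min x (k : ℝ) ∂μ ≤ ∫ x, x ∂μ :=
    integral_mono hi (h.integrable continuous_id subexponential_id) fun x => min_le_left _ _
  rw [integral_lowerApprox h (f := fun x => x) (by fun_prop) subexponential_id k,
    integral_sub hi (integrable_const _)]
  have : 0 < Real.exp (-(k : ℝ) ^ 2) * (2 * k + 1) := by positivity
  simp only [integral_const, probReal_univ, smul_eq_mul, one_mul]
  linarith

theorem tendsto_exp_neg_sq_mul_exp (a : ℝ) :
    Filter.Tendsto (fun k : ℕ => Real.exp (-(k : ℝ) ^ 2) * Real.exp (a * (2 * k + 1)))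
      Filter.atTop (𝓝 0) := by
  -- The exponent `-k ^ 2 + a * (2 * k + 1)` equals `a - k * (k - 2 * a)`. The Gaussian weight thus
  -- beats the exponential growth of any test function at the shifted points.
  have h1 : Filter.Tendsto (fun x : ℝ => a - x * (x - 2 * a)) Filter.atTop Filter.atBot :=
    Filter.tendsto_atBot_add_const_left _ a (Filter.tendsto_neg_atTop_atBot.comp
      (Filter.tendsto_id.atTop_mul_atTop₀ (Filter.tendsto_atTop_add_const_right _ (-(2 * a))
        Filter.tendsto_id)))
  refine (Real.tendsto_exp_atBot.comp (h1.comp tendsto_natCast_atTop_atTop)).congr fun k => ?_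
  simp only [Function.comp_apply]
  rw [← Real.exp_add]
  ring_nf

theorem tendsto_integral_lowerApprox {μ : Measure ℝ} (h : ExpIntegrable μ) {f : ℝ → ℝ}
    (hc : Continuous f) (hf : Subexponential f) :
    Filter.Tendsto (fun k : ℕ => ∫ x, f x ∂lowerApprox μ k) Filter.atTop (𝓝 (∫ x, f x ∂μ)) := by
  obtain ⟨c, C, hc0, hC0, hb⟩ := hf.exists_nonneg
  have hexp : Integrable (fun x => Real.exp (c * |x|)) μ :=
    h.integrable (by fun_prop) (subexponential_exp_abs c)
  have h0 : Filter.Tendsto (fun k : ℕ => Real.exp (-(k : ℝ) ^ 2)) Filter.atTop (𝓝 0) := by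
    simpa using tendsto_exp_neg_sq_mul_exp 0
  have h1 : Filter.Tendsto (fun k : ℕ => ∫ x, f (min x k) ∂μ) Filter.atTop
      (𝓝 (∫ x, f x ∂μ)) := by
    refine tendsto_integral_of_dominated_convergence (fun x => C * Real.exp (c * |x|))
      (fun k => (show Continuous fun x : ℝ => f (min x k) by fun_prop).aestronglyMeasurable)
      (hexp.const_mul C) (fun k => ae_of_all _ fun x => ?_) (ae_of_all _ fun x => ?_)
    · refine (hb _).trans ?_
      have := abs_min_natCast_le x k
      gcongr
    · obtain ⟨K, hK⟩ := exists_nat_ge x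
      refine tendsto_const_nhds.congr' ?_
      filter_upwards [Filter.eventually_ge_atTop K] with k hk
      rw [min_eq_left (hK.trans (by exact_mod_cast hk))]
  have h2 : Filter.Tendsto (fun k : ℕ => Real.exp (-(k : ℝ) ^ 2) *
      ∫ x, f (min x k - (2 * k + 1)) ∂μ) Filter.atTop (𝓝 0) := by
    have hz := (tendsto_exp_neg_sq_mul_exp c).mul_const (C * ∫ x, Real.exp (c * |x|) ∂μ)
    rw [zero_mul] at hz
    refine squeeze_zero_norm (fun k => ?_) hz
    rw [norm_mul, Real.norm_of_nonneg (Real.exp_pos _).le, mul_assoc]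
    gcongr
    rw [← integral_const_mul, ← integral_const_mul]
    refine norm_integral_le_of_norm_le ((hexp.const_mul C).const_mul _) (ae_of_all _ fun x => ?_)
    calc |f (min x k - (2 * k + 1))| ≤ C * Real.exp (c * |min x k - (2 * k + 1)|) := hb _
      _ ≤ C * Real.exp (c * (2 * k + 1) + c * |x|) := by
        rw [← mul_add]
        have := abs_min_natCast_sub_le x k
        gcongr
        linarith
      _ = _ := by rw [Real.exp_add]; ring
  have h3 := ((tendsto_const_nhds (x := (1 : ℝ))).sub h0).mul h1 |>.add h2
  rw [sub_zero, one_mul, add_zero] at h3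
  exact h3.congr fun k => (integral_lowerApprox h hc hf k).symm

/-! ### Approximation from above -/

/-- The reflection of `lowerApprox`. -/
noncomputable def upperApprox (ν : Measure ℝ) (k : ℕ) : Measure ℝ :=
  (lowerApprox (ν.map Neg.neg) k).map Neg.neg

instance isProbabilityMeasure_map_neg (ν : Measure ℝ) [IsProbabilityMeasure ν] :
    IsProbabilityMeasure (ν.map Neg.neg) := Measure.isProbabilityMeasure_map (by fun_prop)

instance isProbabilityMeasure_upperApprox (ν : Measure ℝ) [IsProbabilityMeasure ν] (k : ℕ) :
    IsProbabilityMeasure (upperApprox ν k) :=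
  isProbabilityMeasure_map_neg _

theorem ExpIntegrable.upperApprox {ν : Measure ℝ} (h : ExpIntegrable ν) (k : ℕ) :
    ExpIntegrable (StDom.upperApprox ν k) :=
  (h.map_neg.lowerApprox k).map_neg

theorem tendsto_integral_upperApprox {ν : Measure ℝ} (h : ExpIntegrable ν) {f : ℝ → ℝ}
    (hc : Continuous f) (hf : Subexponential f) :
    Filter.Tendsto (fun k : ℕ => ∫ x, f x ∂upperApprox ν k) Filter.atTop (𝓝 (∫ x, f x ∂ν)) := by
  have := tendsto_integral_lowerApprox h.map_neg (f := fun x => f (-x)) (by fun_prop)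
    (hf.comp (a := 0) fun x => by simp)
  rw [integral_map (by fun_prop)
    (show Continuous fun x => f (-x) by fun_prop).aestronglyMeasurable] at this
  simp only [neg_neg] at this
  refine this.congr fun k => ?_
  rw [upperApprox, integral_map (by fun_prop) hc.aestronglyMeasurable]

/-! ### Necessity and density -/

/-- Both log-Laplace transforms vanish at `0` with derivative the mean, so the order of their right
slopes passes to the means. -/
theorem integral_le_of_mgf_le {μ ν : Measure ℝ} [IsProbabilityMeasure μ] [IsProbabilityMeasure ν]
    (hμ : ExpIntegrable μ) (hν : ExpIntegrable ν)
    (h : ∀ l, 0 ≤ l → mgf id μ l ≤ mgf id ν l) : ∫ x, x ∂μ ≤ ∫ x, x ∂ν := by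
  refine le_of_tendsto_of_tendsto hμ.hasDerivAt_cgf_zero.tendsto_slope_zero_right
    hν.hasDerivAt_cgf_zero.tendsto_slope_zero_right ?_
  filter_upwards [self_mem_nhdsWithin] with l hl
  have hl : 0 < l := hl
  simp only [zero_add, cgf_zero, sub_zero, smul_eq_mul]
  exact mul_le_mul_of_nonneg_left (Real.log_le_log (mgf_pos (hμ l)) (h l hl.le)) (by positivity)

theorem stLEStar_lowerApprox_upperApprox {μ ν : Measure ℝ} [IsProbabilityMeasure μ]
    [IsProbabilityMeasure ν] (hμ : ExpIntegrable μ) (hν : ExpIntegrable ν)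
    (hpos : ∀ l, 0 ≤ l → mgf id μ l ≤ mgf id ν l) (hneg : ∀ l, l ≤ 0 → mgf id ν l ≤ mgf id μ l)
    (k : ℕ) : StLEStar (lowerApprox μ k) (upperApprox ν k) := by
  refine stLEStar_of_strict (b := k) (c := k + 1) (b' := -k) (c' := -k - 1) (hμ.lowerApprox k)
    (hν.upperApprox k) (lowerApprox_Ioi μ k) ?_ (by linarith) ?_ (lowerApprox_Iic_ne_zero μ k)
    (by linarith) (fun l hl => ?_) (fun l hl => ?_) ?_
  · rw [upperApprox, Measure.map_apply measurable_neg measurableSet_Ici]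
    have e : (-k - 1 : ℝ) = -(k + 1) := by ring
    simpa [e] using lowerApprox_Iic_ne_zero (ν.map Neg.neg) k
  · rw [upperApprox, Measure.map_apply measurable_neg measurableSet_Iio]
    simpa using lowerApprox_Ioi (ν.map Neg.neg) k
  · refine (mgf_lowerApprox_lt hμ k hl).trans_le ((hpos l hl.le).trans ?_)
    have := (lt_mgf_lowerApprox hν.map_neg k (l := -l) (by linarith)).le
    rwa [mgf_map_neg, neg_neg, ← mgf_map_neg] at this
  · refine lt_of_le_of_lt ((?_ : _ ≤ mgf id ν l).trans (hneg l hl.le)) (lt_mgf_lowerApprox hμ k hl)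
    have := (mgf_lowerApprox_lt hν.map_neg k (l := -l) (by linarith)).le
    rwa [mgf_map_neg ν, neg_neg, ← mgf_map_neg] at this
  · refine (mean_lowerApprox_lt hμ k).trans_le ((integral_le_of_mgf_le hμ hν hpos).trans ?_)
    have := mean_lowerApprox_lt hν.map_neg k
    rw [integral_map (μ := ν) (by fun_prop) (by fun_prop), integral_neg] at this
    rw [upperApprox, integral_map (by fun_prop) (by fun_prop), integral_neg]
    linarith

/-- Stochastic domination implies domination of the Laplace transforms at nonnegative arguments. -/
theorem StLE.lintegral_exp_le {μ ν : Measure ℝ} (h : StLE μ ν) {l : ℝ} (hl : 0 < l) :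
    ∫⁻ x, ENNReal.ofReal (Real.exp (l * x)) ∂μ ≤ ∫⁻ x, ENNReal.ofReal (Real.exp (l * x)) ∂ν := by
  rw [lintegral_eq_lintegral_meas_le μ (ae_of_all _ fun _ => (Real.exp_pos _).le) (by fun_prop),
    lintegral_eq_lintegral_meas_le ν (ae_of_all _ fun _ => (Real.exp_pos _).le) (by fun_prop)]
  refine setLIntegral_mono' measurableSet_Ioi fun t ht => ?_
  have ht : 0 < t := ht
  have e : {x : ℝ | t ≤ Real.exp (l * x)} = Set.Ici (Real.log t / l) := by
    ext x
    simp only [Set.mem_ofPred_eq, Set.mem_Ici]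
    rw [← Real.log_le_iff_le_exp ht, div_le_iff₀ hl, mul_comm]
  rw [e]
  exact h _

theorem mgf_le_of_stLEStar {μ ν : Measure ℝ} [IsProbabilityMeasure μ] [IsProbabilityMeasure ν]
    (hμ : ExpIntegrable μ) (hν : ExpIntegrable ν) (h : StLEStar μ ν) {l : ℝ} (hl : 0 ≤ l) :
    mgf id μ l ≤ mgf id ν l := by
  obtain ⟨n, hn, h⟩ := h
  -- At `l = 0` both transforms equal `1`; for `l > 0` the superlevel sets of the exponential are
  -- closed upper half-lines.
  rcases hl.eq_or_lt with rfl | hl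
  · simp
  have := h.lintegral_exp_le hl
  rw [lintegral_exp_convPow, lintegral_exp_convPow, hμ.lintegral_exp, hν.lintegral_exp,
    ← ENNReal.ofReal_pow mgf_nonneg, ← ENNReal.ofReal_pow mgf_nonneg,
    ENNReal.ofReal_le_ofReal_iff (pow_nonneg mgf_nonneg n)] at this
  exact le_of_pow_le_pow_left₀ (by omega) mgf_nonneg this

theorem StLEStar.map_neg {μ ν : Measure ℝ} [IsProbabilityMeasure μ] [IsProbabilityMeasure ν]
    (h : StLEStar μ ν) : StLEStar (ν.map Neg.neg) (μ.map Neg.neg) := by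
  obtain ⟨n, hn, h⟩ := h
  refine ⟨n, hn, ?_⟩
  rw [convPow_map_neg, convPow_map_neg]
  exact h.map_neg

/-! ### The topology on exponentially integrable measures -/

theorem continuous_integral_testFun {f : ℝ → ℝ} (hc : Continuous f) (hf : Subexponential f) :
    Continuous fun μ : ExpMeasure => ∫ x, f x ∂μ.meas :=
  (continuous_apply (A := fun _ : TestFun => ℝ) ⟨f, hc, hf⟩).comp
    (continuous_induced_dom (f := fun (μ : ExpMeasure) (f : TestFun) => ∫ x, f.1 x ∂μ.meas))

theorem tendsto_expMeasure_of_integral {u : ℕ → ExpMeasure} {μ : ExpMeasure}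
    (h : ∀ f : ℝ → ℝ, Continuous f → Subexponential f →
      Filter.Tendsto (fun k => ∫ x, f x ∂(u k).meas) Filter.atTop (𝓝 (∫ x, f x ∂μ.meas))) :
    Filter.Tendsto u Filter.atTop (𝓝 μ) := by
  rw [nhds_induced, Filter.tendsto_comap_iff, tendsto_pi_nhds]
  exact fun f => h f.1 f.2.1 f.2.2

theorem ExpMeasure.expIntegrable (μ : ExpMeasure) : ExpIntegrable μ.meas := μ.2

/-- Expresses total mass through a test function; an infinite mass would have real value `0`, so the
value `1` excludes it. -/
theorem ExpMeasure.isProbabilityMeasure_iff (μ : ExpMeasure) :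
    IsProbabilityMeasure μ.meas ↔ ∫ x, Real.exp (0 * x) ∂μ.meas = 1 := by
  simp only [zero_mul, Real.exp_zero, integral_const, smul_eq_mul, mul_one]
  rw [MeasureTheory.isProbabilityMeasure_iff, Measure.real, ENNReal.toReal_eq_one_iff]

theorem isClosed_probPairs : IsClosed probPairs := by
  have hc : Continuous fun μ : ExpMeasure => ∫ x, Real.exp (0 * x) ∂μ.meas :=
    continuous_integral_testFun (by fun_prop) (subexponential_exp 0)
  simp only [probPairs, ExpMeasure.isProbabilityMeasure_iff]
  exact (isClosed_eq (hc.comp continuous_fst) continuous_const).inter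
    (isClosed_eq (hc.comp continuous_snd) continuous_const)

end StDom

/-! ### The closure of the relation. -/

theorem mainTheorem2 :
    closure StDom.relR =
      {p : StDom.ExpMeasure × StDom.ExpMeasure | p ∈ StDom.probPairs ∧
        (∀ l : ℝ, 0 ≤ l →
          ∫ x, Real.exp (l * x) ∂p.1.meas ≤ ∫ x, Real.exp (l * x) ∂p.2.meas) ∧
        (∀ l : ℝ, l ≤ 0 →
          ∫ x, Real.exp (l * x) ∂p.2.meas ≤ ∫ x, Real.exp (l * x) ∂p.1.meas)} := by
  open StDom in
  apply Set.Subset.antisymm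
  · refine closure_minimal ?_ ?_
    · rintro ⟨μ, ν⟩ ⟨hp, h⟩
      have := hp.1
      have := hp.2
      refine ⟨hp, fun l hl => mgf_le_of_stLEStar μ.expIntegrable ν.expIntegrable h hl, fun l hl => ?_⟩
      have := mgf_le_of_stLEStar ν.expIntegrable.map_neg μ.expIntegrable.map_neg h.map_neg (neg_nonneg.2 hl)
      rwa [mgf_map_neg, mgf_map_neg, neg_neg] at this
    · have hc : ∀ l : ℝ, Continuous fun μ : ExpMeasure => ∫ x, Real.exp (l * x) ∂μ.meas :=
        fun l => continuous_integral_testFun (by fun_prop) (subexponential_exp l)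
      simp only [Set.ofPred_and, Set.ofPred_forall]
      refine isClosed_probPairs.inter (IsClosed.inter ?_ ?_)
      · exact isClosed_iInter fun l => isClosed_iInter fun _ =>
          isClosed_le ((hc l).comp continuous_fst) ((hc l).comp continuous_snd)
      · exact isClosed_iInter fun l => isClosed_iInter fun _ =>
          isClosed_le ((hc l).comp continuous_snd) ((hc l).comp continuous_fst)
  · rintro ⟨μ, ν⟩ ⟨hp, hpos, hneg⟩
    have := hp.1
    have := hp.2
    let u : ℕ → ExpMeasure := fun k => ⟨lowerApprox μ.meas k, μ.expIntegrable.lowerApprox k⟩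
    let v : ℕ → ExpMeasure := fun k => ⟨upperApprox ν.meas k, ν.expIntegrable.upperApprox k⟩
    have hu : Filter.Tendsto u Filter.atTop (nhds μ) :=
      tendsto_expMeasure_of_integral fun f hc hf => tendsto_integral_lowerApprox μ.expIntegrable hc hf
    have hv : Filter.Tendsto v Filter.atTop (nhds ν) :=
      tendsto_expMeasure_of_integral fun f hc hf => tendsto_integral_upperApprox ν.expIntegrable hc hf
    refine mem_closure_of_tendsto (hu.prodMk_nhds hv) (Filter.Eventually.of_forall fun k => ?_)
    exact ⟨⟨isProbabilityMeasure_lowerApprox μ.meas k, isProbabilityMeasure_upperApprox ν.meas k⟩,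
      stLEStar_lowerApprox_upperApprox μ.expIntegrable ν.expIntegrable hpos hneg k⟩
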